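/- Let $\mathbb{D}=\{z\in\mathbb{C}:|z|<1\}$, let $H^\infty(\mathbb{D})$ be the algebra of bounded holomorphic functions on $\mathbb{D}$ with the supremum norm $\|f\|=\sup_{z\in\mathbb{D}}|f(z)|$, and let $$H^\infty_1(\mathbb{D})=\{f\in H^\infty(\mathbb{D}) : f'(0)=0\}$$ be the Neil algebra, with the same norm. Let $T:H^\infty_1(\mathbb{D})\to H^\infty_1(\mathbb{D})$ be a surjective complex-linear isometry. Then there exist $\alpha\in\mathbb{C}$ with $|\alpha|=1$ and $\theta\in\mathbb{R}$ such that $$(Tf)(z)=\alpha f(e^{i\theta}z)\qquad\text{for all } f\in H^\infty_1(\mathbb{D}),\ z\in\mathbb{D}.$$ -/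

import Mathlib

open Complex Metric
open scoped Complex.UnitDisc BoundedContinuousFunction

noncomputable section

/-- The function on `ℂ` which equals `f` on the open unit disc and `0` outside of it. It is only
used to speak about complex differentiability of `f` at points of the (open) disc. -/
def discExtend (f : 𝔻 → ℂ) : ℂ → ℂ :=
  fun z => if hz : ‖z‖ < 1 then f (UnitDisc.mk z hz) else 0

theorem discExtend_of_norm_lt_one (f : 𝔻 → ℂ) {z : ℂ} (hz : ‖z‖ < 1) :
    discExtend f z = f (UnitDisc.mk z hz) := dif_pos hz

theorem discExtend_add (f g : 𝔻 →ᵇ ℂ) :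
    discExtend (f + g : 𝔻 →ᵇ ℂ) = discExtend f + discExtend g := by
  funext z
  by_cases hz : ‖z‖ < 1 <;> simp [discExtend, hz]

theorem discExtend_mul (f g : 𝔻 →ᵇ ℂ) :
    discExtend (f * g : 𝔻 →ᵇ ℂ) = discExtend f * discExtend g := by
  funext z
  by_cases hz : ‖z‖ < 1 <;> simp [discExtend, hz]

theorem discExtend_algebraMap_eqOn (c : ℂ) :
    Set.EqOn (discExtend (algebraMap ℂ (𝔻 →ᵇ ℂ) c)) (fun _ => c) (ball 0 1) := by
  intro z hz
  have hz' : ‖z‖ < 1 := by simpa using hz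
  simp [discExtend, hz']

/-- `H^∞(𝔻)`: the algebra of bounded holomorphic functions on the open unit disc, with the
supremum norm (inherited from the bounded continuous functions on the disc). -/
def HInfty : Subalgebra ℂ (𝔻 →ᵇ ℂ) where
  carrier := {f | DifferentiableOn ℂ (discExtend f) (ball 0 1)}
  add_mem' {f g} hf hg := by
    simp only [Set.mem_ofPred_eq, discExtend_add] at *
    exact hf.add hg
  mul_mem' {f g} hf hg := by
    simp only [Set.mem_ofPred_eq, discExtend_mul] at *
    exact hf.mul hg
  algebraMap_mem' c :=
    (differentiableOn_const c).congr (discExtend_algebraMap_eqOn c)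

theorem HInfty.differentiableAt_zero {f : 𝔻 →ᵇ ℂ} (hf : f ∈ HInfty) :
    DifferentiableAt ℂ (discExtend f) 0 :=
  DifferentiableOn.differentiableAt (s := ball 0 1) hf (ball_mem_nhds 0 one_pos)

/-- The Neil algebra `H^∞_1(𝔻) = {f ∈ H^∞(𝔻) : f'(0) = 0}`, with the supremum norm. -/
def NeilAlgebra : Subalgebra ℂ (𝔻 →ᵇ ℂ) where
  carrier := {f | f ∈ HInfty ∧ deriv (discExtend f) 0 = 0}
  add_mem' {f g} hf hg := by
    refine ⟨HInfty.add_mem hf.1 hg.1, ?_⟩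
    rw [discExtend_add, deriv_add (HInfty.differentiableAt_zero hf.1)
      (HInfty.differentiableAt_zero hg.1), hf.2, hg.2, add_zero]
  mul_mem' {f g} hf hg := by
    refine ⟨HInfty.mul_mem hf.1 hg.1, ?_⟩
    rw [discExtend_mul, deriv_mul (HInfty.differentiableAt_zero hf.1)
      (HInfty.differentiableAt_zero hg.1), hf.2, hg.2, zero_mul, mul_zero, add_zero]
  algebraMap_mem' c := by
    refine ⟨HInfty.algebraMap_mem c, ?_⟩
    rw [((discExtend_algebraMap_eqOn c).eventuallyEq_of_mem
      (ball_mem_nhds 0 one_pos)).deriv_eq]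
    exact deriv_const 0 c

end

/-! Point evaluations norm the algebra, so by Hahn-Banach the dual unit ball lies in the weak-*
closed convex hull of the unimodular multiples of characters. These form a weak-* compact set, which
by Milman contains all extreme points. The adjoint of `T` preserves extreme points, and by
Krein-Milman only `0` is killed by all of them; hence `T 1 * T (f * g) = T f * T g`.

It follows that `T 1` is unimodular on the disc, thus a constant `α`, and that `f ↦ α⁻¹ (T f)(z)` is
a character. Its values `p`, `q` on `z ^ 2`, `z ^ 3` lie on the cusp `p ^ 3 = q ^ 2`, which is
parametrized by `(w ^ 2, w ^ 3)`; since `|p| < 1`, the character is evaluation at a point `φ z = w`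
of the disc. The map `φ` is bijective, and holomorphic because its square and cube are. Finally `T
(z ^ 2) = α φ ^ 2` has zero derivative at `0` while `φ' 0 ≠ 0`, so `φ 0 = 0`, and the Schwarz lemma
makes `φ` a rotation. -/

section Milman

/-! ### Compact convex hulls and Milman's theorem -/

variable {E : Type*} [AddCommGroup E] [Module ℝ E] [TopologicalSpace E]
  [IsTopologicalAddGroup E] [ContinuousSMul ℝ E]

theorem IsCompact.convexHull_union {s t : Set E} (hs : IsCompact s) (ht : IsCompact t)
    (hs' : Convex ℝ s) (ht' : Convex ℝ t) : IsCompact (convexHull ℝ (s ∪ t)) := by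
  rcases s.eq_empty_or_nonempty with rfl | hsn
  · rwa [Set.empty_union, ht'.convexHull_eq]
  rcases t.eq_empty_or_nonempty with rfl | htn
  · rwa [Set.union_empty, hs'.convexHull_eq]
  rw [hs'.convexHull_union ht' hsn htn]
  have : convexJoin ℝ s t =
      (fun p : ℝ × E × E => (1 - p.1) • p.2.1 + p.1 • p.2.2) '' (Set.Icc 0 1 ×ˢ s ×ˢ t) := by
    ext x
    simp only [mem_convexJoin, segment_eq_image, Set.mem_image, Set.mem_prod, Prod.exists]
    constructor
    · rintro ⟨a, ha, b, hb, r, hr, rfl⟩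
      exact ⟨r, a, b, ⟨hr, ha, hb⟩, rfl⟩
    · rintro ⟨r, a, b, ⟨hr, ha, hb⟩, rfl⟩
      exact ⟨a, ha, b, hb, r, hr, rfl⟩
  rw [this]
  exact (isCompact_Icc.prod (hs.prod ht)).image (by fun_prop)

theorem isCompact_convexHull_biUnion {ι : Type*} (I : Finset ι) {K : ι → Set E}
    (hK : ∀ i, IsCompact (K i)) (hK' : ∀ i, Convex ℝ (K i)) :
    IsCompact (convexHull ℝ (⋃ i ∈ I, K i)) := by
  classical
  induction I using Finset.induction_on with
  | empty => simp
  | insert a I _ ih =>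
    rw [Finset.set_biUnion_insert, ← convexHull_convexHull_union_right]
    exact (hK a).convexHull_union ih (hK' a) (convex_convexHull ℝ _)

/-- **Milman's converse of the Krein-Milman theorem**: if a compact convex set is contained in the
closed convex hull of a compact set, then that set contains its extreme points. -/
theorem extremePoints_subset_of_subset_closure_convexHull [T2Space E] [LocallyConvexSpace ℝ E]
    {K S : Set E} (hK : IsCompact K) (hKc : Convex ℝ K) (hS : IsCompact S) (hSK : S ⊆ K)
    (hKS : K ⊆ closure (convexHull ℝ S)) : K.extremePoints ℝ ⊆ S := by
  intro x hx
  by_contra hxS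
  have hV : ∀ s ∈ S, ∃ V ∈ nhds s, IsClosed V ∧ Convex ℝ V ∧ x ∉ V := by
    intro s hs
    have hsx : s ≠ x := by rintro rfl; exact hxS hs
    obtain ⟨C, ⟨hC, hCc⟩, hCx⟩ := (closed_nhds_basis s).mem_iff.1 (isOpen_ne.mem_nhds hsx)
    obtain ⟨W, ⟨hW, hWc⟩, hWC⟩ := (LocallyConvexSpace.convex_basis (𝕜 := ℝ) s).mem_iff.1 hC
    refine ⟨closure W, Filter.mem_of_superset hW subset_closure, isClosed_closure, hWc.closure,
      fun hxW => hCx (closure_minimal hWC hCc hxW) rfl⟩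
  choose! V hVn hVc hVconv hxV using hV
  obtain ⟨I, hIS, hI⟩ := hS.elim_nhds_subcover V hVn
  -- The cover is reindexed by points of `S`: the properties of `V` hold only there, while the
  -- compactness lemma asks for them at every index.
  obtain ⟨J, hJ⟩ : ∃ J : Finset S, ∀ s, s ∈ I ↔ ∃ h : s ∈ S, (⟨s, h⟩ : S) ∈ J := by
    classical
    refine ⟨I.subtype (· ∈ S), fun s => ?_⟩
    simp only [Finset.mem_subtype]
    exact ⟨fun h => ⟨hIS s h, h⟩, fun h => h.2⟩
  have hcomp : IsCompact (convexHull ℝ (⋃ s ∈ J, K ∩ V s.1)) :=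
    isCompact_convexHull_biUnion J (fun s => hK.inter_right (hVc _ s.2))
      (fun s => hKc.inter (hVconv _ s.2))
  have hSU : S ⊆ ⋃ s ∈ J, K ∩ V s.1 := by
    intro y hy
    obtain ⟨s, hs, hys⟩ := Set.mem_iUnion₂.1 (hI hy)
    obtain ⟨h, hsJ⟩ := (hJ s).1 hs
    exact Set.mem_iUnion₂.2 ⟨⟨s, h⟩, hsJ, hSK hy, hys⟩
  have hKU : K ⊆ convexHull ℝ (⋃ s ∈ J, K ∩ V s.1) :=
    hKS.trans (closure_minimal (convexHull_mono hSU) hcomp.isClosed)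
  have hUK : convexHull ℝ (⋃ s ∈ J, K ∩ V s.1) ⊆ K :=
    convexHull_min (Set.iUnion₂_subset fun s _ => Set.inter_subset_left) hKc
  -- `K` is the hull of finitely many pieces, so its extreme point `x` lies in one of them; but
  -- every `V s` misses `x`.
  rw [hKU.antisymm hUK] at hx
  obtain ⟨s, _, hs⟩ := Set.mem_iUnion₂.1 (extremePoints_convexHull_subset hx)
  exact hxV _ s.2 hs.2

end Milman

/-! ### The weak dual as a real locally convex space -/

section WeakDual

variable {E : Type*} [NormedAddCommGroup E] [NormedSpace ℂ E]

/-- The real vector space structure obtained by restriction of scalars. It is singled out because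
the default real structure does not unify with the additive group structure of the weak dual. -/
noncomputable instance (priority := 2000) weakDualRealModule :
    @Module ℝ (WeakDual ℂ E) _ AddCommGroup.toAddCommMonoid := Module.complexToReal _

instance : IsScalarTower ℝ ℂ (WeakDual ℂ E) :=
  ⟨fun r c φ => DFunLike.ext _ _ fun f => smul_assoc r c (φ f)⟩

instance : @ContinuousSMul ℝ (WeakDual ℂ E) (weakDualRealModule (E := E)).toSMul _ _ :=
  IsScalarTower.continuousSMul ℂ

instance : @LocallyConvexSpace ℝ (WeakDual ℂ E) _ _ AddCommGroup.toAddCommMonoid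
    weakDualRealModule _ :=
  (WeakDual.withSeminorms ℂ E).toLocallyConvexSpace

end WeakDual

/-! ### Isometries of function algebras via extreme functionals -/

section FunctionAlgebra

variable (A : Type*) [NormedAddCommGroup A] [NormedSpace ℂ A]

/-- The closed unit ball of the dual of a normed algebra, with the weak-* topology. -/
def dualUnitBall : Set (WeakDual ℂ A) := {ψ | ∀ f : A, ‖ψ f‖ ≤ ‖f‖}

theorem isCompact_dualUnitBall : IsCompact (dualUnitBall A) := by
  have h : dualUnitBall A = WeakDual.toStrongDual ⁻¹' closedBall (0 : StrongDual ℂ A) 1 := by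
    ext ψ
    rw [Set.mem_preimage, mem_closedBall_zero_iff, ContinuousLinearMap.opNorm_le_iff zero_le_one]
    simp only [one_mul]
    rfl
  rw [h]
  exact WeakDual.isCompact_closedBall (𝕜 := ℂ) (E := A) 0 1

theorem convex_dualUnitBall : Convex ℝ (dualUnitBall A) := by
  intro ψ hψ χ hχ a b ha hb hab f
  have h : (a • ψ + b • χ) f = a • ψ f + b • χ f := rfl
  rw [h]
  calc ‖a • ψ f + b • χ f‖ ≤ ‖a • ψ f‖ + ‖b • χ f‖ := norm_add_le _ _
    _ = a * ‖ψ f‖ + b * ‖χ f‖ := by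
      rw [norm_smul, norm_smul, Real.norm_of_nonneg ha, Real.norm_of_nonneg hb]
    _ ≤ a * ‖f‖ + b * ‖f‖ := by gcongr; exacts [hψ f, hχ f]
    _ = ‖f‖ := by rw [← add_mul, hab, one_mul]

variable {A}

/-- Precomposition of a functional with a linear isometry. -/
noncomputable def precomp (T : A ≃ₗᵢ[ℂ] A) (ψ : WeakDual ℂ A) : WeakDual ℂ A :=
  StrongDual.toWeakDual
    ((WeakDual.toStrongDual ψ).comp (T.toContinuousLinearEquiv : A →L[ℂ] A))

theorem precomp_apply (T : A ≃ₗᵢ[ℂ] A) (ψ : WeakDual ℂ A) (f : A) : precomp T ψ f = ψ (T f) := rfl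

theorem precomp_mem_dualUnitBall (T : A ≃ₗᵢ[ℂ] A) {ψ : WeakDual ℂ A} (hψ : ψ ∈ dualUnitBall A) :
    precomp T ψ ∈ dualUnitBall A := fun f => by
  rw [precomp_apply, ← T.norm_map f]
  exact hψ _

theorem precomp_mem_extremePoints (T : A ≃ₗᵢ[ℂ] A) {ψ : WeakDual ℂ A}
    (hψ : ψ ∈ (dualUnitBall A).extremePoints ℝ) :
    precomp T ψ ∈ (dualUnitBall A).extremePoints ℝ := by
  rw [mem_extremePoints_iff_left] at hψ ⊢
  refine ⟨precomp_mem_dualUnitBall T hψ.1, ?_⟩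
  rintro a ha b hb ⟨s, t, hs, ht, hst, h⟩
  -- Composing with `T.symm` turns a decomposition of `precomp T ψ` into one of `ψ`.
  have key : precomp T.symm a = ψ := by
    refine hψ.2 _ (precomp_mem_dualUnitBall T.symm ha) _ (precomp_mem_dualUnitBall T.symm hb)
      ⟨s, t, hs, ht, hst, DFunLike.ext _ _ fun f => ?_⟩
    have := DFunLike.congr_fun h (T.symm f)
    rw [precomp_apply, T.apply_symm_apply] at this
    exact this
  refine DFunLike.ext _ _ fun f => ?_
  rw [← key, precomp_apply, precomp_apply, T.symm_apply_apply]

variable (A) [Mul A] [One A]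

/-- The functionals in the dual unit ball which are unimodular multiples of characters. -/
def unimodularCharacters : Set (WeakDual ℂ A) :=
  {ψ | ψ ∈ dualUnitBall A ∧ ‖ψ 1‖ = 1 ∧ ∀ f g, ψ 1 * ψ (f * g) = ψ f * ψ g}

theorem isCompact_unimodularCharacters : IsCompact (unimodularCharacters A) := by
  refine (isCompact_dualUnitBall A).of_isClosed_subset ?_ fun ψ h => h.1
  have hev : ∀ f : A, Continuous fun ψ : WeakDual ℂ A => ψ f := WeakDual.eval_continuous
  have h : unimodularCharacters A = dualUnitBall A ∩ ({ψ | ‖ψ 1‖ = 1} ∩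
      ⋂ f : A, ⋂ g : A, {ψ | ψ 1 * ψ (f * g) = ψ f * ψ g}) := by
    ext ψ
    simp only [Set.mem_inter_iff, Set.mem_iInter]
    rfl
  rw [h]
  exact (isCompact_dualUnitBall A).isClosed.inter <|
    (isClosed_eq (hev 1).norm continuous_const).inter <|
    isClosed_iInter fun f => isClosed_iInter fun g =>
      isClosed_eq ((hev 1).mul (hev _)) ((hev f).mul (hev g))

variable {A}

/-- A norming family of characters of `A`: it exhibits `A` as a function algebra on `X`, with the
supremum norm. -/
structure IsNorming {X : Type*} (δ : X → A →ₗ[ℂ] ℂ) : Prop where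
  map_one : ∀ x, δ x 1 = 1
  map_mul : ∀ x f g, δ x (f * g) = δ x f * δ x g
  norm_le_iff : ∀ (f : A) (C : ℝ), 0 ≤ C → (‖f‖ ≤ C ↔ ∀ x, ‖δ x f‖ ≤ C)

variable {X : Type*} {δ : X → A →ₗ[ℂ] ℂ}

theorem IsNorming.norm_apply_le (hδ : IsNorming δ) (x : X) (f : A) : ‖δ x f‖ ≤ ‖f‖ :=
  (hδ.norm_le_iff f ‖f‖ (norm_nonneg f)).1 le_rfl x

theorem IsNorming.exists_mem_unimodularCharacters (hδ : IsNorming δ) {c : ℂ} (hc : ‖c‖ = 1)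
    (x : X) : ∃ ψ ∈ unimodularCharacters A, ∀ f, ψ f = c * δ x f := by
  have hb : ∀ f, ‖(c • (δ x)) f‖ ≤ 1 * ‖f‖ := fun f => by
    simpa [hc] using hδ.norm_apply_le x f
  refine ⟨StrongDual.toWeakDual ((c • (δ x)).mkContinuous 1 hb),
    ⟨fun f => (hb f).trans_eq (one_mul _), ?_, fun f g => ?_⟩, fun f => rfl⟩
  · change ‖c * δ x 1‖ = 1
    rw [hδ.map_one, mul_one, hc]
  · change c * δ x 1 * (c * δ x (f * g)) = c * δ x f * (c * δ x g)
    rw [hδ.map_one, hδ.map_mul]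
    ring

/-- A weak-* continuous functional separating `ψ` from the hull is evaluation at some `f`. Rotating
each `δ x f` onto the positive axis bounds `‖f‖` by the separating constant, which `ψ f` would
exceed. -/
theorem IsNorming.dualUnitBall_subset_closure_convexHull [Nonempty X] (hδ : IsNorming δ) :
    dualUnitBall A ⊆ closure (convexHull ℝ (unimodularCharacters A)) := by
  intro ψ hψ
  by_contra hne
  obtain ⟨l, u, hl, hu⟩ := RCLike.geometric_hahn_banach_closed_point (𝕜 := ℂ)
    (convex_convexHull ℝ (unimodularCharacters A)).closure isClosed_closure hne
  obtain ⟨f, rfl⟩ := LinearMap.dualEmbedding_surjective (topDualPairing ℂ A) l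
  have hl' : ∀ c : ℂ, ‖c‖ = 1 → ∀ x, (c * δ x f).re < u := fun c hc x => by
    obtain ⟨φ, hφ, h⟩ := hδ.exists_mem_unimodularCharacters hc x
    rw [← h]
    exact hl φ (subset_closure (subset_convexHull ℝ _ hφ))
  have hfx : ∀ x, ‖δ x f‖ ≤ u := by
    intro x
    obtain ⟨c, hc, hcf⟩ : ∃ c : ℂ, ‖c‖ = 1 ∧ c * δ x f = ‖δ x f‖ := by
      by_cases h : δ x f = 0
      · exact ⟨1, by simp, by simp [h]⟩
      · have h' : ‖δ x f‖ ≠ 0 := norm_ne_zero_iff.2 h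
        refine ⟨‖δ x f‖ / δ x f, ?_, div_mul_cancel₀ _ h⟩
        rw [norm_div, Complex.norm_real, norm_norm, div_self h']
    have := hl' c hc x
    rw [hcf, Complex.ofReal_re] at this
    exact this.le
  obtain ⟨x⟩ := ‹Nonempty X›
  have hf : ‖f‖ ≤ u := (hδ.norm_le_iff f u ((norm_nonneg _).trans (hfx x))).2 hfx
  have hu' : u < (ψ f).re := hu
  exact absurd ((Complex.re_le_norm _).trans ((hψ f).trans hf)) (not_le.2 hu')

theorem IsNorming.extremePoints_dualUnitBall_subset [Nonempty X] (hδ : IsNorming δ) :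
    (dualUnitBall A).extremePoints ℝ ⊆ unimodularCharacters A :=
  extremePoints_subset_of_subset_closure_convexHull (isCompact_dualUnitBall A)
    (convex_dualUnitBall A) (isCompact_unimodularCharacters A) (fun _ h => h.1)
    hδ.dualUnitBall_subset_closure_convexHull

/-- A function in the algebra vanishes if all extreme points of the dual unit ball kill it. -/
theorem IsNorming.eq_zero_of_extremePoints (hδ : IsNorming δ) {f : A}
    (hf : ∀ ψ ∈ (dualUnitBall A).extremePoints ℝ, ψ f = 0) : f = 0 := by
  have hsub : dualUnitBall A ⊆ {ψ : WeakDual ℂ A | ψ f = 0} := by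
    rw [← closure_convexHull_extremePoints (isCompact_dualUnitBall A) (convex_dualUnitBall A)]
    refine closure_minimal (convexHull_min hf ?_)
      (isClosed_eq (WeakDual.eval_continuous f) continuous_const)
    intro ψ hψ χ hχ a b _ _ _
    have h : (a • ψ + b • χ) f = a • ψ f + b • χ f := rfl
    have h1 : ψ f = 0 := hψ
    have h2 : χ f = 0 := hχ
    change (a • ψ + b • χ) f = 0
    rw [h, h1, h2, smul_zero, smul_zero, add_zero]
  rw [← norm_le_zero_iff, hδ.norm_le_iff f 0 le_rfl]
  intro x
  obtain ⟨φ, hφ, h⟩ := hδ.exists_mem_unimodularCharacters norm_one x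
  rw [← one_mul (δ x f), ← h, norm_le_zero_iff]
  exact hsub hφ.1

/-- A surjective linear isometry of a function algebra is multiplicative up to the factor `T 1`. -/
theorem IsNorming.map_one_mul_map_mul [Nonempty X] (hδ : IsNorming δ) (T : A ≃ₗᵢ[ℂ] A) (f g : A) :
    T 1 * T (f * g) = T f * T g := by
  rw [← sub_eq_zero]
  refine hδ.eq_zero_of_extremePoints fun ψ hψ => ?_
  -- Both `ψ` and `ψ ∘ T` are extreme, hence multiples of characters; comparing the two product
  -- rules gives the identity at `ψ`.
  obtain ⟨_, h1, hm⟩ := hδ.extremePoints_dualUnitBall_subset hψ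
  obtain ⟨_, _, hT⟩ := hδ.extremePoints_dualUnitBall_subset (precomp_mem_extremePoints T hψ)
  have h0 : ψ 1 ≠ 0 := norm_ne_zero_iff.1 (by rw [h1]; exact one_ne_zero)
  refine mul_left_cancel₀ h0 ?_
  rw [map_sub, mul_sub, hm, hm, mul_zero, sub_eq_zero]
  exact hT f g

/-- The image of `1` under a surjective linear isometry is invertible, and unimodular. -/
theorem IsNorming.norm_apply_map_one [Nonempty X] (hδ : IsNorming δ) (T : A ≃ₗᵢ[ℂ] A) (x : X) :
    ‖δ x (T 1)‖ = 1 := by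
  have h1 : ‖(1 : A)‖ ≤ 1 := (hδ.norm_le_iff 1 1 zero_le_one).2 fun x => by simp [hδ.map_one]
  have hle : ∀ f : A, ‖f‖ ≤ 1 → ‖δ x f‖ ≤ 1 := fun f hf => (hδ.norm_apply_le x f).trans hf
  set g := T.symm 1
  have hg : ‖g‖ ≤ 1 := by rwa [T.symm.norm_map]
  have hgg : ‖g * g‖ ≤ 1 := (hδ.norm_le_iff _ 1 zero_le_one).2 fun x => by
    rw [hδ.map_mul, norm_mul]
    have := (hδ.norm_apply_le x g).trans hg
    exact mul_le_one₀ this (norm_nonneg _) this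
  have ha := hle (T 1) (by rwa [T.norm_map])
  have hb := hle (T (g * g)) (by rwa [T.norm_map])
  -- As `T g = 1`, the identity reads `T 1 * T (g * g) = 1`, a product of two factors of modulus at
  -- most `1`.
  have h := congrArg (fun f => ‖δ x f‖) (hδ.map_one_mul_map_mul T g g)
  simp only [g, T.apply_symm_apply, hδ.map_mul, hδ.map_one, norm_mul, mul_one, norm_one] at h hb
  refine ha.antisymm ?_
  rw [← h]
  exact mul_le_of_le_one_right (norm_nonneg _) hb

end FunctionAlgebra

noncomputable section

/-! ### Holomorphic maps of the disc -/

section Disc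

theorem discExtend_coe (f : 𝔻 → ℂ) (z : 𝔻) : discExtend f z = f z :=
  (discExtend_of_norm_lt_one f z.norm_lt_one).trans (congrArg f (UnitDisc.mk_coe z))

theorem discExtend_eqOn {f : 𝔻 → ℂ} {F : ℂ → ℂ} (h : ∀ z : 𝔻, f z = F z) :
    Set.EqOn (discExtend f) F (ball 0 1) := fun z hz => by
  rw [discExtend_of_norm_lt_one f (mem_ball_zero_iff.1 hz), h, UnitDisc.coe_mk]

/-- If the square and the cube of a function on the disc are holomorphic, and the function has
exactly one zero, then it is holomorphic. -/
theorem differentiableOn_of_sq_of_cube {Φ : ℂ → ℂ} {a : ℂ} (ha : a ∈ ball (0 : ℂ) 1)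
    (h2 : DifferentiableOn ℂ (fun z => Φ z ^ 2) (ball 0 1))
    (h3 : DifferentiableOn ℂ (fun z => Φ z ^ 3) (ball 0 1))
    (h0 : ∀ z ∈ ball (0 : ℂ) 1, Φ z = 0 ↔ z = a) : DifferentiableOn ℂ Φ (ball 0 1) := by
  rw [← differentiableOn_compl_singleton_and_continuousAt_iff (isOpen_ball.mem_nhds ha)]
  constructor
  · have hne : ∀ z ∈ ball (0 : ℂ) 1 \ {a}, Φ z ≠ 0 := fun z hz h => hz.2 ((h0 z hz.1).1 h)
    -- Away from `a`, `Φ` is the quotient `Φ ^ 3 / Φ ^ 2`; at `a` continuity suffices, by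
    -- removability of the singularity.
    refine ((h3.mono Set.sdiff_subset).div (h2.mono Set.sdiff_subset)
      fun z hz => pow_ne_zero 2 (hne z hz)).congr fun z hz => ?_
    have := hne z hz
    simp only [Pi.div_apply]
    field_simp
  · have ha0 : Φ a = 0 := (h0 a ha).2 rfl
    have hc : ContinuousAt (fun z => √‖Φ z ^ 2‖) a :=
      (h2.differentiableAt (isOpen_ball.mem_nhds ha)).continuousAt.norm.sqrt
    have hs : (fun z => √‖Φ z ^ 2‖) = fun z => ‖Φ z‖ := by
      funext z
      rw [norm_pow, Real.sqrt_sq (norm_nonneg _)]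
    rw [hs, ContinuousAt, ha0, norm_zero] at hc
    rw [ContinuousAt, ha0]
    exact tendsto_zero_iff_norm_tendsto_zero.2 hc

/-- A holomorphic bijection of the disc fixing the origin, with holomorphic inverse, is a
rotation. -/
theorem exists_eq_mul_of_inverse {Φ Ψ : ℂ → ℂ} (hΦ : DifferentiableOn ℂ Φ (ball 0 1))
    (hΨ : DifferentiableOn ℂ Ψ (ball 0 1)) (mΦ : Set.MapsTo Φ (ball 0 1) (ball 0 1))
    (mΨ : Set.MapsTo Ψ (ball 0 1) (ball 0 1)) (hΨΦ : ∀ z ∈ ball (0 : ℂ) 1, Ψ (Φ z) = z)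
    (h0 : Φ 0 = 0) : ∃ c : ℂ, ‖c‖ = 1 ∧ ∀ z ∈ ball (0 : ℂ) 1, Φ z = c * z := by
  have h0' : Ψ 0 = 0 := by rw [← h0, hΨΦ 0 (mem_ball_self one_pos), h0]
  have hnorm : ∀ z ∈ ball (0 : ℂ) 1, ‖Φ z‖ = ‖z‖ := fun z hz =>
    (norm_le_norm_of_mapsTo_ball hΦ (mΦ.mono_right ball_subset_closedBall) h0
      (mem_ball_zero_iff.1 hz)).antisymm <| by
    conv_lhs => rw [← hΨΦ z hz]
    exact norm_le_norm_of_mapsTo_ball hΨ (mΨ.mono_right ball_subset_closedBall) h0'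
      (mem_ball_zero_iff.1 (mΦ hz))
  have hhalf : (1 / 2 : ℂ) ∈ ball (0 : ℂ) 1 := by rw [mem_ball_zero_iff]; norm_num
  -- Equality in the Schwarz lemma at one nonzero point, here `1 / 2`, forces linearity.
  obtain ⟨c, hc, hcΦ⟩ := affine_of_mapsTo_ball_of_exists_norm_dslope_eq_div' (R₂ := 1) hΦ
    (by rw [h0]; exact mΦ.mono_right ball_subset_closedBall) ⟨1 / 2, hhalf, by
      rw [dslope_of_ne _ (by norm_num), slope_def_field, h0, norm_div, sub_zero, sub_zero,
        hnorm _ hhalf, div_self (by norm_num), div_one]⟩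
  refine ⟨c, by rwa [div_one] at hc, fun z hz => ?_⟩
  rw [hcΦ hz]
  simp [h0, mul_comm]

end Disc

/-! ### Elements and characters of the Neil algebra -/

namespace NeilAlgebra

theorem differentiableOn (f : NeilAlgebra) :
    DifferentiableOn ℂ (discExtend (f : 𝔻 →ᵇ ℂ)) (ball 0 1) := f.2.1

theorem deriv_zero (f : NeilAlgebra) : deriv (discExtend (f : 𝔻 →ᵇ ℂ)) 0 = 0 := f.2.2

/-- The element of the Neil algebra defined by a function which is bounded and holomorphic on the
disc, with vanishing derivative at the origin. -/
def ofFun (F : ℂ → ℂ) (hd : DifferentiableOn ℂ F (ball 0 1)) (C : ℝ)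
    (hb : ∀ z ∈ ball (0 : ℂ) 1, ‖F z‖ ≤ C) (h0 : deriv F 0 = 0) : NeilAlgebra :=
  ⟨BoundedContinuousFunction.ofNormedAddCommGroup (fun z : 𝔻 => F z)
    (hd.continuousOn.comp_continuous UnitDisc.continuous_coe
      fun z => mem_ball_zero_iff.2 z.norm_lt_one) C
    fun z => hb z (mem_ball_zero_iff.2 z.norm_lt_one), by
    have h : Set.EqOn (discExtend fun z : 𝔻 => F z) F (ball 0 1) := discExtend_eqOn fun _ => rfl
    refine ⟨hd.congr h, ?_⟩
    exact (h.eventuallyEq_of_mem (ball_mem_nhds 0 one_pos)).deriv_eq.trans h0⟩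

/-- Multiplication by `z ^ 2` maps bounded holomorphic functions to the Neil algebra. -/
theorem exists_eq_sq_mul {G : ℂ → ℂ} (hd : DifferentiableOn ℂ G (ball 0 1)) {C : ℝ}
    (hb : ∀ z ∈ ball (0 : ℂ) 1, ‖G z‖ ≤ C) :
    ∃ g : NeilAlgebra, ∀ z : 𝔻, (g : 𝔻 →ᵇ ℂ) z = (z : ℂ) ^ 2 * G z := by
  refine ⟨ofFun (fun z => z ^ 2 * G z) ((differentiableOn_id.pow 2).mul hd) C
    (fun z hz => ?_) ?_, fun z => rfl⟩
  · rw [norm_mul, norm_pow]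
    have hz1 : ‖z‖ ^ 2 ≤ 1 := pow_le_one₀ (norm_nonneg z) (mem_ball_zero_iff.1 hz).le
    exact (mul_le_of_le_one_left (norm_nonneg _) hz1).trans (hb z hz)
  · have h := ((hasDerivAt_id (0 : ℂ)).pow 2).mul
      (hd.differentiableAt (ball_mem_nhds 0 one_pos)).hasDerivAt
    exact h.deriv.trans (by simp)

/-- The function `z ^ (n + 2)` of the Neil algebra. -/
def monomial (n : ℕ) : NeilAlgebra :=
  ofFun (fun z => z ^ (n + 2)) (differentiableOn_id.pow _) 1
    (fun z hz => by
      rw [norm_pow]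
      exact pow_le_one₀ (norm_nonneg z) (mem_ball_zero_iff.1 hz).le)
    (by simp)

theorem monomial_apply (n : ℕ) (z : 𝔻) : (monomial n : 𝔻 →ᵇ ℂ) z = (z : ℂ) ^ (n + 2) := rfl

/-- Evaluation at a point of the disc. -/
def eval (z : 𝔻) : NeilAlgebra →ₗ[ℂ] ℂ where
  toFun f := (f : 𝔻 →ᵇ ℂ) z
  map_add' _ _ := rfl
  map_smul' _ _ := rfl

theorem eval_apply (z : 𝔻) (f : NeilAlgebra) : eval z f = (f : 𝔻 →ᵇ ℂ) z := rfl

theorem isNorming_eval : IsNorming eval where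
  map_one _ := rfl
  map_mul _ _ _ := rfl
  norm_le_iff f _ hC := BoundedContinuousFunction.norm_le (f := (f : 𝔻 →ᵇ ℂ)) hC

theorem ext_apply {f g : NeilAlgebra} (h : ∀ z, (f : 𝔻 →ᵇ ℂ) z = (g : 𝔻 →ᵇ ℂ) z) : f = g :=
  Subtype.ext (BoundedContinuousFunction.ext h)

/-- The difference quotient of an element of the Neil algebra is bounded and holomorphic. -/
theorem exists_sub_eq_mul (f : NeilAlgebra) (w : 𝔻) : ∃ (G : ℂ → ℂ) (C : ℝ),
    DifferentiableOn ℂ G (ball 0 1) ∧ (∀ z ∈ ball (0 : ℂ) 1, ‖G z‖ ≤ C) ∧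
      ∀ z : 𝔻, (f : 𝔻 →ᵇ ℂ) z - (f : 𝔻 →ᵇ ℂ) w = (z - w) * G z := by
  set F := discExtend (f : 𝔻 →ᵇ ℂ)
  have hw : ball (0 : ℂ) 1 ∈ nhds (w : ℂ) :=
    isOpen_ball.mem_nhds (mem_ball_zero_iff.2 w.norm_lt_one)
  have hG : DifferentiableOn ℂ (dslope F w) (ball 0 1) :=
    (differentiableOn_dslope hw).2 (NeilAlgebra.differentiableOn f)
  have hcont : ContinuousAt (dslope F w) w := (hG.differentiableAt hw).continuousAt
  obtain ⟨r, hr, hrb⟩ := Metric.eventually_nhds_iff.1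
    (hcont.norm.eventually (gt_mem_nhds (lt_add_one ‖dslope F w w‖)))
  have hF : ∀ z ∈ ball (0 : ℂ) 1, ‖F z‖ ≤ ‖f‖ := fun z hz => by
    rw [show F z = _ from discExtend_of_norm_lt_one _ (mem_ball_zero_iff.1 hz)]
    exact (f : 𝔻 →ᵇ ℂ).norm_coe_le_norm _
  -- The first bound holds near `w` by continuity; at distance at least `r` the quotient is at most
  -- `2‖f‖ / r`.
  refine ⟨dslope F w, max (‖dslope F w w‖ + 1) ((‖f‖ + ‖f‖) / r), hG, fun z hz => ?_, fun z => ?_⟩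
  · rcases lt_or_ge (dist z w) r with h | h
    · exact le_max_of_le_left (hrb h).le
    · refine le_max_of_le_right ?_
      have hne : z ≠ w := by
        rintro rfl
        rw [dist_self] at h
        exact absurd hr (not_lt.2 h)
      rw [dslope_of_ne _ hne, slope_def_field, norm_div]
      rw [dist_eq_norm] at h
      gcongr
      · exact (norm_sub_le _ _).trans
          (add_le_add (hF z hz) (hF w (mem_ball_zero_iff.2 w.norm_lt_one)))
  · have h := sub_smul_dslope F (w : ℂ) z
    rw [smul_eq_mul] at h
    rw [h]
    exact (congrArg₂ (· - ·) (discExtend_coe _ z) (discExtend_coe _ w)).symm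

/-- A unital multiplicative functional on the Neil algebra taking the values `w ^ 2` and `w ^ 3` on
the generating monomials is the evaluation at `w`. -/
theorem character_eq_eval (χ : NeilAlgebra →ₗ[ℂ] ℂ) (h1 : χ 1 = 1)
    (hm : ∀ f g, χ (f * g) = χ f * χ g) {w : 𝔻} (h2 : χ (monomial 0) = (w : ℂ) ^ 2)
    (h3 : χ (monomial 1) = (w : ℂ) ^ 3) (f : NeilAlgebra) : χ f = (f : 𝔻 →ᵇ ℂ) w := by
  obtain ⟨G, C, hd, hb, hG⟩ := exists_sub_eq_mul f w
  set c := (f : 𝔻 →ᵇ ℂ) w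
  rw [← sub_eq_zero]
  by_cases hw : (w : ℂ) = 0
  -- With `w = 0`, `(f - c) ^ 4 = z ^ 2 * (z ^ 2 * G ^ 4)`. The fourth power leaves a spare `z ^ 2`,
  -- which puts the cofactor in the algebra.
  · obtain ⟨k, hk⟩ := exists_eq_sq_mul (hd.pow 4) (C := C ^ 4) fun z hz => by
      simpa only [Pi.pow_apply, norm_pow] using pow_le_pow_left₀ (norm_nonneg _) (hb z hz) 4
    have hmul : ((f - c • 1) * (f - c • 1)) * ((f - c • 1) * (f - c • 1)) = monomial 0 * k :=
      ext_apply fun z => by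
        have hz := hG z
        change (((f : 𝔻 →ᵇ ℂ) z - c * 1) * ((f : 𝔻 →ᵇ ℂ) z - c * 1)) *
          (((f : 𝔻 →ᵇ ℂ) z - c * 1) * ((f : 𝔻 →ᵇ ℂ) z - c * 1)) =
            (z : ℂ) ^ (0 + 2) * (k : 𝔻 →ᵇ ℂ) z
        rw [mul_one, hz, hk, hw, Pi.pow_apply]
        ring
    have h := congrArg χ hmul
    rw [hm, hm, hm, map_sub, map_smul, h1, h2, hw, smul_eq_mul, mul_one, zero_pow two_ne_zero,
      zero_mul] at h
    simpa using h
  -- `G` itself may lie outside the algebra, but `g = z ^ 2 * G` does not. The multiplier `z ^ 3 + w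
  -- * z ^ 2` completes `z - w` to `z ^ 2 - w ^ 2`, and `χ` sends it to `2 * w ^ 3 ≠ 0`.
  · obtain ⟨g, hg⟩ := exists_eq_sq_mul hd hb
    have hmul : (f - c • 1) * (monomial 1 + (w : ℂ) • monomial 0) =
        (monomial 0 - (w : ℂ) ^ 2 • 1) * g := ext_apply fun z => by
      have hz := hG z
      change ((f : 𝔻 →ᵇ ℂ) z - c * 1) * ((z : ℂ) ^ (1 + 2) + w * (z : ℂ) ^ (0 + 2)) =
        ((z : ℂ) ^ (0 + 2) - (w : ℂ) ^ 2 * 1) * (g : 𝔻 →ᵇ ℂ) z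
      rw [mul_one, hz, hg]
      ring
    have h := congrArg χ hmul
    rw [hm, hm, map_sub, map_sub, map_add, map_smul, map_smul, map_smul, h1, h2, h3,
      smul_eq_mul, smul_eq_mul, smul_eq_mul, mul_one, mul_one, sub_self, zero_mul] at h
    refine (mul_eq_zero.1 h).resolve_right ?_
    have : (w : ℂ) ^ 3 + w * (w : ℂ) ^ 2 = 2 * (w : ℂ) ^ 3 := by ring
    rw [this]
    exact mul_ne_zero two_ne_zero (pow_ne_zero 3 hw)

end NeilAlgebra

end

/-! ### Isometries as weighted composition operators -/

namespace NeilAlgebra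

/-- Maximum modulus principle: the bound is attained at an interior point. -/
theorem eq_smul_one_of_norm_eq {f : NeilAlgebra} (hf : ‖f‖ ≤ 1) {z : 𝔻}
    (hz : ‖(f : 𝔻 →ᵇ ℂ) z‖ = 1) : f = (f : 𝔻 →ᵇ ℂ) z • 1 := by
  have hle : ∀ w, ‖(f : 𝔻 →ᵇ ℂ) w‖ ≤ 1 := fun w => ((f : 𝔻 →ᵇ ℂ).norm_coe_le_norm w).trans hf
  have hmem : ∀ w : 𝔻, (w : ℂ) ∈ ball (0 : ℂ) 1 := fun w => mem_ball_zero_iff.2 w.norm_lt_one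
  have h := Complex.eqOn_of_isPreconnected_of_isMaxOn_norm
    (convex_ball (0 : ℂ) 1).isPreconnected isOpen_ball (differentiableOn f) (hmem z) fun w hw => by
      change ‖discExtend (f : 𝔻 →ᵇ ℂ) w‖ ≤ ‖discExtend (f : 𝔻 →ᵇ ℂ) z‖
      rw [discExtend_coe, hz, discExtend_of_norm_lt_one _ (mem_ball_zero_iff.1 hw)]
      exact hle _
  refine ext_apply fun w => ?_
  have hw := h (hmem w)
  rw [Function.const_apply, discExtend_coe, discExtend_coe] at hw
  rw [hw]
  exact (mul_one _).symm

theorem monomial_zero_ne_smul_one (c : ℂ) : monomial 0 ≠ c • 1 := by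
  intro h
  have h' : ∀ z : 𝔻, (z : ℂ) ^ (0 + 2) = c * 1 := fun z =>
    DFunLike.congr_fun (congrArg Subtype.val h) z
  have h1 := h' 0
  have h2 := h' (UnitDisc.mk (1 / 2) (by norm_num))
  rw [← h1, UnitDisc.coe_mk, UnitDisc.coe_zero] at h2
  norm_num at h2

theorem norm_monomial_le (n : ℕ) : ‖monomial n‖ ≤ 1 :=
  (isNorming_eval.norm_le_iff _ 1 zero_le_one).2 fun z => by
    rw [eval_apply, monomial_apply, norm_pow]
    exact pow_le_one₀ (norm_nonneg _) z.norm_lt_one.le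

/-- A surjective linear isometry of the Neil algebra is a weighted composition operator, with
constant unimodular weight. -/
theorem exists_eq_mul_comp (T : NeilAlgebra ≃ₗᵢ[ℂ] NeilAlgebra) :
    ∃ (α : ℂ) (φ : 𝔻 → 𝔻), ‖α‖ = 1 ∧
      ∀ (f : NeilAlgebra) (z : 𝔻), (T f : 𝔻 →ᵇ ℂ) z = α * (f : 𝔻 →ᵇ ℂ) (φ z) := by
  have hT1 : ∀ z, ‖(T 1 : 𝔻 →ᵇ ℂ) z‖ = 1 := fun z => isNorming_eval.norm_apply_map_one T z
  set α := (T 1 : 𝔻 →ᵇ ℂ) 0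
  have hα : ‖α‖ = 1 := hT1 0
  have hα0 : α ≠ 0 := norm_ne_zero_iff.1 (by rw [hα]; exact one_ne_zero)
  have hone : ‖(1 : NeilAlgebra)‖ ≤ 1 :=
    (isNorming_eval.norm_le_iff _ 1 zero_le_one).2 fun z => norm_one.le
  have hTα : T 1 = α • 1 := eq_smul_one_of_norm_eq (by rwa [T.norm_map]) hα
  have hTα' : ∀ z, (T 1 : 𝔻 →ᵇ ℂ) z = α := fun z => by
    rw [hTα]
    exact mul_one α
  have hmul : ∀ f g z, α * (T (f * g) : 𝔻 →ᵇ ℂ) z = (T f : 𝔻 →ᵇ ℂ) z * (T g : 𝔻 →ᵇ ℂ) z :=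
    fun f g z => by
      have h := DFunLike.congr_fun
        (congrArg Subtype.val (isNorming_eval.map_one_mul_map_mul T f g)) z
      rw [← hTα' z]
      exact h
  have hw : ∀ z : 𝔻, ∃ w : 𝔻, ∀ f : NeilAlgebra, (T f : 𝔻 →ᵇ ℂ) z = α * (f : 𝔻 →ᵇ ℂ) w := by
    intro z
    let χ : NeilAlgebra →ₗ[ℂ] ℂ :=
      α⁻¹ • (eval z ∘ₗ (T.toLinearEquiv : NeilAlgebra →ₗ[ℂ] NeilAlgebra))
    have hχ : ∀ f, χ f = α⁻¹ * (T f : 𝔻 →ᵇ ℂ) z := fun f => rfl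
    have hχ1 : χ 1 = 1 := by rw [hχ, hTα', inv_mul_cancel₀ hα0]
    have hχm : ∀ f g, χ (f * g) = χ f * χ g := fun f g => by
      have h := hmul f g z
      rw [hχ, hχ, hχ]
      field_simp
      linear_combination h
    have hχn : ∀ f, ‖χ f‖ = ‖(T f : 𝔻 →ᵇ ℂ) z‖ := fun f => by
      rw [hχ, norm_mul, norm_inv, hα, inv_one, one_mul]
    -- Equality would make `T (z ^ 2)` constant, hence the image under `T` of a constant, against
    -- injectivity.
    have hlt : ‖χ (monomial 0)‖ < 1 := by
      rw [hχn]
      have hT2 : ‖T (monomial 0)‖ ≤ 1 := by rw [T.norm_map]; exact norm_monomial_le 0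
      refine lt_of_le_of_ne ((isNorming_eval.norm_apply_le z _).trans hT2) fun h => ?_
      have hc := eq_smul_one_of_norm_eq hT2 h
      set c := (T (monomial 0) : 𝔻 →ᵇ ℂ) z
      refine monomial_zero_ne_smul_one (c * α⁻¹) (T.injective ?_)
      rw [map_smul, hTα, smul_smul, inv_mul_cancel_right₀ hα0]
      exact hc
    have h23 : χ (monomial 0) ^ 3 = χ (monomial 1) ^ 2 := by
      have h : monomial 0 * monomial 0 * monomial 0 = monomial 1 * monomial 1 :=
        ext_apply fun z => by
          change (z : ℂ) ^ (0 + 2) * (z : ℂ) ^ (0 + 2) * (z : ℂ) ^ (0 + 2) =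
            (z : ℂ) ^ (1 + 2) * (z : ℂ) ^ (1 + 2)
          ring
      have := congrArg χ h
      rw [hχm, hχm, hχm] at this
      linear_combination this
    obtain ⟨w, hw2, hw3⟩ : ∃ w : ℂ, χ (monomial 0) = w ^ 2 ∧ χ (monomial 1) = w ^ 3 := by
      set p := χ (monomial 0)
      set q := χ (monomial 1)
      by_cases hp : p = 0
      · have hq : q = 0 := by
          rw [hp, zero_pow three_ne_zero] at h23
          exact pow_eq_zero_iff two_ne_zero |>.1 h23.symm
        exact ⟨0, by rw [hp]; simp, by rw [hq]; simp⟩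
      · refine ⟨q / p, ?_, ?_⟩
        · field_simp
          exact h23
        · field_simp
          rw [h23]
          ring
    have hw1 : ‖w‖ < 1 := by
      rw [hw2, norm_pow] at hlt
      exact (pow_lt_one_iff_of_nonneg (norm_nonneg w) two_ne_zero).1 hlt
    refine ⟨UnitDisc.mk w hw1, fun f => ?_⟩
    rw [← character_eq_eval χ hχ1 hχm (w := UnitDisc.mk w hw1) hw2 hw3 f, hχ,
      mul_inv_cancel_left₀ hα0]
  choose φ hφ using hw
  exact ⟨α, φ, hα, fun f z => hφ z f⟩

/-- The squares and cubes separate the points of the disc. -/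
theorem eq_of_monomial_eq {z w : 𝔻} (h : ∀ n, (z : ℂ) ^ (n + 2) = (w : ℂ) ^ (n + 2)) : z = w := by
  have h2 := h 0
  have h3 := h 1
  rw [zero_add] at h2
  apply UnitDisc.coe_injective
  by_cases hw : (w : ℂ) = 0
  · rw [hw, zero_pow two_ne_zero] at h2
    rw [hw]
    exact (pow_eq_zero_iff two_ne_zero).1 h2
  · refine mul_right_cancel₀ (pow_ne_zero 2 hw) ?_
    linear_combination h3 - (z : ℂ) * h2

theorem leftInverse_of_comp (T : NeilAlgebra ≃ₗᵢ[ℂ] NeilAlgebra) {α β : ℂ} {φ ψ : 𝔻 → 𝔻}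
    (hT : ∀ (f : NeilAlgebra) (z : 𝔻), (T f : 𝔻 →ᵇ ℂ) z = α * (f : 𝔻 →ᵇ ℂ) (φ z))
    (hT' : ∀ (f : NeilAlgebra) (z : 𝔻), (T.symm f : 𝔻 →ᵇ ℂ) z = β * (f : 𝔻 →ᵇ ℂ) (ψ z)) :
    Function.LeftInverse ψ φ := by
  have h : ∀ (f : NeilAlgebra) (z : 𝔻),
      (f : 𝔻 →ᵇ ℂ) z = α * (β * (f : 𝔻 →ᵇ ℂ) (ψ (φ z))) := fun f z => by
    rw [← hT', ← hT, T.apply_symm_apply]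
  have hαβ : α * (β * 1) = 1 := (h 1 0).symm
  refine fun z => (eq_of_monomial_eq fun n => ?_).symm
  have := h (monomial n) z
  rw [monomial_apply, monomial_apply] at this
  linear_combination this + (ψ (φ z) : ℂ) ^ (n + 2) * hαβ

theorem differentiableOn_of_comp {T : NeilAlgebra → NeilAlgebra} {α : ℂ} (hα : α ≠ 0)
    {φ ψ : 𝔻 → 𝔻}
    (hT : ∀ (f : NeilAlgebra) (z : 𝔻), (T f : 𝔻 →ᵇ ℂ) z = α * (f : 𝔻 →ᵇ ℂ) (φ z))
    (hφψ : Function.LeftInverse φ ψ) (hψφ : Function.LeftInverse ψ φ) :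
    DifferentiableOn ℂ (discExtend fun z => (φ z : ℂ)) (ball 0 1) := by
  have hpow : ∀ n : ℕ,
      DifferentiableOn ℂ (fun z => discExtend (fun z => (φ z : ℂ)) z ^ (n + 2)) (ball 0 1) := by
    intro n
    refine ((differentiableOn (T (monomial n))).const_mul α⁻¹).congr fun z hz => ?_
    have hz' := mem_ball_zero_iff.1 hz
    rw [discExtend_of_norm_lt_one _ hz', discExtend_of_norm_lt_one _ hz', hT, monomial_apply,
      inv_mul_cancel_left₀ hα]
  -- By bijectivity the only zero of `φ` is `ψ 0`.
  refine differentiableOn_of_sq_of_cube (a := ψ 0) (mem_ball_zero_iff.2 (ψ 0).norm_lt_one)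
    (hpow 0) (hpow 1) fun z hz => ?_
  rw [discExtend_of_norm_lt_one _ (mem_ball_zero_iff.1 hz), UnitDisc.coe_eq_zero,
    ← hφψ.injective.eq_iff, hψφ, ← UnitDisc.coe_inj, UnitDisc.coe_mk]

end NeilAlgebra

/-! ### The main theorem -/

theorem corollaryC3 (T : NeilAlgebra →ₗᵢ[ℂ] NeilAlgebra) (hT : Function.Surjective T) :
    ∃ (α : Circle) (θ : ℝ), ∀ (f : NeilAlgebra) (z : 𝔻),
      (T f : 𝔻 →ᵇ ℂ) z = (α : ℂ) * (f : 𝔻 →ᵇ ℂ) (Circle.exp θ • z) := by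
  set U : NeilAlgebra ≃ₗᵢ[ℂ] NeilAlgebra := LinearIsometryEquiv.ofSurjective T hT
  obtain ⟨α, φ, hα, hU⟩ := NeilAlgebra.exists_eq_mul_comp U
  obtain ⟨β, ψ, hβ, hV⟩ := NeilAlgebra.exists_eq_mul_comp U.symm
  have hα0 : α ≠ 0 := norm_ne_zero_iff.1 (by rw [hα]; exact one_ne_zero)
  have hβ0 : β ≠ 0 := norm_ne_zero_iff.1 (by rw [hβ]; exact one_ne_zero)
  have hψφ := NeilAlgebra.leftInverse_of_comp U hU hV
  have hφψ := NeilAlgebra.leftInverse_of_comp U.symm hV hU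
  have hΦ := NeilAlgebra.differentiableOn_of_comp hα0 hU hφψ hψφ
  have hΨ := NeilAlgebra.differentiableOn_of_comp hβ0 hV hψφ hφψ
  have mapsTo : ∀ χ : 𝔻 → 𝔻, Set.MapsTo (discExtend fun z => (χ z : ℂ)) (ball 0 1) (ball 0 1) :=
    fun χ z hz => by
      rw [discExtend_of_norm_lt_one _ (mem_ball_zero_iff.1 hz)]
      exact mem_ball_zero_iff.2 (χ _).norm_lt_one
  have hΨΦ : ∀ z ∈ ball (0 : ℂ) 1,
      discExtend (fun z => (ψ z : ℂ)) (discExtend (fun z => (φ z : ℂ)) z) = z := fun z hz => by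
    rw [discExtend_of_norm_lt_one _ (mem_ball_zero_iff.1 hz), discExtend_coe, hψφ, UnitDisc.coe_mk]
  have hball := ball_mem_nhds (0 : ℂ) one_pos
  -- The chain rule for `ψ ∘ φ = id` gives `φ' 0 ≠ 0`, whereas membership of `α φ ^ 2` in the Neil
  -- algebra gives `2 α φ(0) φ'(0) = 0`.
  have hΦ0 : discExtend (fun z => (φ z : ℂ)) 0 = 0 := by
    have hΦd := (hΦ.differentiableAt hball).hasDerivAt
    have hΨd := (hΨ.differentiableAt
      (isOpen_ball.mem_nhds (mapsTo φ (mem_ball_self one_pos)))).hasDerivAt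
    have hinv : deriv (discExtend fun z => (ψ z : ℂ)) (discExtend (fun z => (φ z : ℂ)) 0) *
        deriv (discExtend fun z => (φ z : ℂ)) 0 = 1 :=
      (hΨd.comp 0 hΦd).unique <| (hasDerivAt_id 0).congr_of_eventuallyEq
        (Filter.eventually_of_mem hball hΨΦ)
    have hsq := (hΦd.pow 2).const_mul α
    have heq : (fun z => α * (discExtend (fun z => (φ z : ℂ)) ^ 2) z) =ᶠ[nhds 0]
        discExtend (U (NeilAlgebra.monomial 0) : 𝔻 →ᵇ ℂ) :=
      Filter.eventually_of_mem hball fun z hz => by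
        have hz' := mem_ball_zero_iff.1 hz
        change α * discExtend (fun z => (φ z : ℂ)) z ^ 2 = _
        rw [discExtend_of_norm_lt_one _ hz', discExtend_of_norm_lt_one _ hz', hU,
          NeilAlgebra.monomial_apply]
    have hzero := hsq.deriv.symm.trans (heq.deriv_eq.trans (NeilAlgebra.deriv_zero _))
    have hd0 := right_ne_zero_of_mul_eq_one hinv
    simpa [hα0, hd0] using hzero
  obtain ⟨c, hc, hcΦ⟩ := exists_eq_mul_of_inverse hΦ hΨ (mapsTo φ) (mapsTo ψ) hΨΦ hΦ0
  refine ⟨⟨α, mem_sphere_zero_iff_norm.2 hα⟩, arg c, fun f z => ?_⟩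
  have hφz : Circle.exp (arg c) • z = φ z := UnitDisc.coe_injective <| by
    have h := hcΦ z (mem_ball_zero_iff.2 z.norm_lt_one)
    rw [discExtend_coe] at h
    rw [UnitDisc.coe_circle_smul, Circle.coe_exp, h]
    have := norm_mul_exp_arg_mul_I c
    rw [hc, ofReal_one, one_mul] at this
    rw [this]
  rw [hφz]
  exact hU f z
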